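/- Let $R$ be a quasi-Frobenius ring, i.e. a ring that is left and right artinian and left and right self-injective. Suppose that $R$ has infinite global dimension. Let $\mathrm{Mod}(R)$ be the category of all left $R$-modules, and let $\mathrm{mod}(R)$ be its full abelian subcategory of finitely generated left $R$-modules. Let $$F \colon D(\mathrm{mod}(R)) \to D(\mathrm{Mod}(R))$$ be the functor between unbounded derived categories induced by the exact inclusion $\mathrm{mod}(R) \subset \mathrm{Mod}(R)$. Let $D_{\mathrm{mod}(R)}(\mathrm{Mod}(R)) \subset D(\mathrm{Mod}(R))$ be the full subcategory of all objects $C$ with $H^i(C)$ finitely generated for every $i \in \mathbb{Z}$. Then $F$ is not full, and the closure of the essential image of $F$ under direct summands in $D(\mathrm{Mod}(R))$ is strictly contained in $D_{\mathrm{mod}(R)}(\mathrm{Mod}(R))$. In particular, the induced functor $D(\mathrm{mod}(R)) \to D_{\mathrm{mod}(R)}(\mathrm{Mod}(R))$ is not an equivalence. -/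

import Mathlib

open CategoryTheory CategoryTheory.Limits

universe w₁ w₂ u

/-- A ring `R` is quasi-Frobenius if it is left and right artinian, and left and right
self-injective. Right `R`-modules are modules over the opposite ring `Rᵐᵒᵖ`. -/
class IsQuasiFrobenius (R : Type u) [Ring R] : Prop where
  left_artinian : IsArtinian R R
  right_artinian : IsArtinian Rᵐᵒᵖ R
  left_injective : Module.Injective R R
  right_injective : Module.Injective Rᵐᵒᵖ R

/-- A quasi-Frobenius ring is left noetherian, by the Hopkins-Levitzki theorem. -/
instance IsQuasiFrobenius.isNoetherianRing (R : Type u) [Ring R] [h : IsQuasiFrobenius R] :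
    IsNoetherianRing R :=
  haveI : IsArtinianRing R := h.left_artinian
  inferInstance

/-- The (left) global dimension of `R`: the supremum of the projective dimensions of all
(left) `R`-modules. -/
noncomputable def globalDimension (R : Type u) [Ring R] : WithBot ℕ∞ :=
  ⨆ M : ModuleCat.{u} R, projectiveDimension M

section Functor

variable (R : Type u) [Ring R] [IsNoetherianRing R]

/-- The inclusion `mod R ⥤ Mod R` of the finitely generated modules over a left noetherian ring
into all modules. -/
abbrev modInclusion : FGModuleCat.{u} R ⥤ ModuleCat.{u} R := (ModuleCat.isFG.{u} R).ι

instance modInclusion_preservesFiniteLimits : PreservesFiniteLimits (modInclusion R) :=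
  inferInstanceAs (PreservesFiniteLimits (forget₂ (FGModuleCat.{u} R) (ModuleCat.{u} R)))

instance modInclusion_preservesFiniteColimits : PreservesFiniteColimits (modInclusion R) :=
  inferInstanceAs (PreservesFiniteColimits (forget₂ (FGModuleCat.{u} R) (ModuleCat.{u} R)))

variable [HasDerivedCategory.{w₁} (FGModuleCat.{u} R)] [HasDerivedCategory.{w₂} (ModuleCat.{u} R)]

/-- The functor `D(mod R) ⥤ D(Mod R)` between unbounded derived categories that is induced by
the exact inclusion `mod R ⥤ Mod R`. -/
noncomputable def derivedModInclusion :
    DerivedCategory (FGModuleCat.{u} R) ⥤ DerivedCategory (ModuleCat.{u} R) :=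
  (modInclusion R).mapDerivedCategory

end Functor

/-- The full subcategory `D_{mod R}(Mod R)` of `D(Mod R)`, as a property of objects: all
cohomology modules are finitely generated. -/
def hasFGCohomology (R : Type u) [Ring R] [HasDerivedCategory.{w₂} (ModuleCat.{u} R)] :
    ObjectProperty (DerivedCategory (ModuleCat.{u} R)) :=
  fun X => ∀ n : ℤ,
    ModuleCat.isFG.{u} R ((DerivedCategory.homologyFunctor (ModuleCat.{u} R) n).obj X)

section Induced

variable (R : Type u) [Ring R] [IsNoetherianRing R]
  [HasDerivedCategory.{w₁} (FGModuleCat.{u} R)] [HasDerivedCategory.{w₂} (ModuleCat.{u} R)]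

lemma hasFGCohomology_derivedModInclusion_obj (X : DerivedCategory (FGModuleCat.{u} R)) :
    hasFGCohomology R ((derivedModInclusion R).obj X) := by
  intro n
  let K : CochainComplex (FGModuleCat.{u} R) ℤ := DerivedCategory.Q.objPreimage X
  let K' := ((modInclusion R).mapHomologicalComplex (ComplexShape.up ℤ)).obj K
  let e : (derivedModInclusion R).obj X ≅ DerivedCategory.Q.obj K' :=
    (derivedModInclusion R).mapIso (DerivedCategory.Q.objObjPreimageIso X).symm ≪≫
      (modInclusion R).mapDerivedCategoryFactors.app K
  let e' : (DerivedCategory.homologyFunctor (ModuleCat.{u} R) n).obj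
      ((derivedModInclusion R).obj X) ≅ (modInclusion R).obj (K.homology n) :=
    (DerivedCategory.homologyFunctor _ n).mapIso e ≪≫
      (DerivedCategory.homologyFunctorFactors _ n).app K' ≪≫
      (K.sc n).mapHomologyIso (modInclusion R)
  have : Module.Finite R ((modInclusion R).obj (K.homology n)) := (K.homology n).property
  exact Module.Finite.equiv e'.symm.toLinearEquiv

/-- The induced functor `D(mod R) ⥤ D_{mod R}(Mod R)`. -/
noncomputable def derivedModInclusionLift :
    DerivedCategory (FGModuleCat.{u} R) ⥤ (hasFGCohomology R).FullSubcategory :=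
  (hasFGCohomology R).lift (derivedModInclusion R) (hasFGCohomology_derivedModInclusion_obj R)

end Induced

/-! Infinite global dimension prevents `R` from being semisimple, so some simple module `S` is not
projective. Finitely generated modules over `R` embed into finitely generated free modules, which
are injective. Splicing resolutions thus gives an acyclic complex `T` of finitely generated
projective-injective modules with `S = coker (T⁻² → T⁻¹)`. The witness is `B = ⨁ₙ Bₙ`, where `Bₙ` is
the brutal truncation of `T` to the degrees from `-n-2` to `n`.

`B` is assembled by triangles from complexes with finitely generated terms
(`CochainComplex.prop_sumBands_of_isTriangulated`): what must be removed from the acyclic complex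
`⨁ₙ T`, namely the degrees `> n` and the degrees `< -n-2` of the `n`-th copy, involves finitely many
`n` in each degree. So `B` has finitely generated cohomology, and it would lie in the essential
image of `F` if `F` were full, since that image would then be a triangulated subcategory.

`B` is not a retract of any `X` with `X⁻¹` finitely generated
(`CochainComplex.isEmpty_retract_sumBands`). Each `Bₙ` is K-projective and K-injective, so a
retraction would give chain maps `Bₙ → X → Bₘ` homotopic to the identity for `n = m` and to zero
otherwise. They induce maps `S → Z → S` with `Z = X⁻¹ / im X⁻²`. A homotopy changes the composite
only by an endomorphism of `S` through a projective, which is zero. Hence `Z` would contain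
infinitely many independent copies of `S`, although it is noetherian. -/

/-! ### Annihilators and embeddings into free modules -/

/-- Over a right self-injective ring, a finitely generated left ideal is the left annihilator of
its right annihilator. -/
lemma Ideal.mem_of_forall_mul_eq_zero {R : Type u} [Ring R] [Module.Injective Rᵐᵒᵖ R]
    {I : Ideal R} (hI : I.FG) {b : R}
    (hb : ∀ x : R, (∀ a ∈ I, a * x = 0) → b * x = 0) : b ∈ I := by
  obtain ⟨n, a, rfl⟩ := Submodule.fg_iff_exists_fin_generating_family.1 hI
  let φ : R →ₗ[Rᵐᵒᵖ] (Fin n → R) :=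
    { toFun := fun x i => a i * x
      map_add' := fun x y => by ext i; simp [mul_add]
      map_smul' := fun r x => by ext i; simp [mul_assoc] }
  let g : R →ₗ[Rᵐᵒᵖ] R :=
    { toFun := fun x => b * x
      map_add' := fun x y => by simp [mul_add]
      map_smul' := fun r x => by simp [mul_assoc] }
  have hle : LinearMap.ker φ ≤ LinearMap.ker g := by
    intro x hx
    refine hb x fun c hc => ?_
    induction hc using Submodule.span_induction with
    | mem c hc => obtain ⟨i, rfl⟩ := hc; exact congrFun hx i
    | zero => simp
    | add c d _ _ hc hd => rw [add_mul, hc, hd, add_zero]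
    | smul r c _ hc => rw [smul_eq_mul, mul_assoc, hc, mul_zero]
  -- Left multiplication by `b` factors through the image of `φ` in `Rⁿ` and so extends to `Rⁿ`;
  -- evaluating the extension at `φ 1 = (aᵢ)` writes `b` as a left combination of the `aᵢ`.
  obtain ⟨G, hG⟩ := Module.Injective.out ((LinearMap.ker φ).liftQ φ le_rfl)
    (LinearMap.ker_eq_bot.1 ((LinearMap.ker φ).ker_liftQ_eq_bot φ le_rfl le_rfl))
    ((LinearMap.ker φ).liftQ g hle)
  have hGφ : G (φ 1) = b := by
    simpa [g] using hG ((LinearMap.ker φ).mkQ 1)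
  have hsum : φ 1 = ∑ i, MulOpposite.op (a i) • (Pi.single i (1 : R) : Fin n → R) := by
    ext j
    simp [φ, Finset.sum_apply, Pi.single_apply]
  rw [← hGφ, hsum, map_sum]
  refine Submodule.sum_mem _ fun i _ => ?_
  rw [map_smul, op_smul_eq_mul]
  exact Ideal.mul_mem_left _ _ (Submodule.subset_span ⟨i, rfl⟩)

section

variable {R : Type u} [Ring R] [IsQuasiFrobenius R]

instance : Module.Injective R R := IsQuasiFrobenius.left_injective

instance : Module.Injective Rᵐᵒᵖ R := IsQuasiFrobenius.right_injective

instance : IsArtinianRing R := IsQuasiFrobenius.left_artinian (R := R)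

/-- The regular module over a quasi-Frobenius ring is a cogenerator. -/
lemma IsQuasiFrobenius.exists_linearMap_ne_zero {M : Type u} [AddCommGroup M] [Module R M]
    {x : M} (hx : x ≠ 0) : ∃ f : M →ₗ[R] R, f x ≠ 0 := by
  let t := LinearMap.toSpanSingleton R M x
  have hker : LinearMap.ker t ≠ ⊤ := by
    intro h
    have : (1 : R) ∈ LinearMap.ker t := h ▸ Submodule.mem_top
    exact hx (by simpa [t] using this)
  -- The annihilator of `x` is a proper left ideal, so by the double annihilator property it kills
  -- some `y ≠ 0`. Then `x ↦ y` is well defined on `R x` and extends to `M`.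
  obtain ⟨y, hy, hy0⟩ : ∃ y : R, (∀ a ∈ LinearMap.ker t, a * y = 0) ∧ y ≠ 0 := by
    by_contra! H
    refine hker ((Ideal.eq_top_iff_one _).2 (Ideal.mem_of_forall_mul_eq_zero
      (IsNoetherian.noetherian _) fun x hx => ?_))
    rw [H x hx, mul_zero]
  have hle : LinearMap.ker t ≤ LinearMap.ker (LinearMap.toSpanSingleton R R y) :=
    fun a ha => LinearMap.mem_ker.2 (hy a ha)
  obtain ⟨h, hh⟩ := Module.Injective.out ((LinearMap.ker t).liftQ t le_rfl)
    (LinearMap.ker_eq_bot.1 ((LinearMap.ker t).ker_liftQ_eq_bot t le_rfl le_rfl))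
    ((LinearMap.ker t).liftQ (LinearMap.toSpanSingleton R R y) hle)
  refine ⟨h, ?_⟩
  have := hh ((LinearMap.ker t).mkQ 1)
  rw [Submodule.mkQ_apply, Submodule.liftQ_apply, Submodule.liftQ_apply,
    LinearMap.toSpanSingleton_apply, LinearMap.toSpanSingleton_apply, one_smul, one_smul] at this
  rwa [this]

/-- A finitely generated module over a quasi-Frobenius ring embeds into a finitely generated free
module. -/
lemma IsQuasiFrobenius.exists_injective_linearMap (M : Type u) [AddCommGroup M] [Module R M]
    [Module.Finite R M] : ∃ (n : ℕ) (f : M →ₗ[R] (Fin n → R)), Function.Injective f := by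
  -- A map with minimal kernel is injective: adjoining a functional that is nonzero at a kernel
  -- element would shrink the kernel.
  obtain ⟨N, ⟨n, f, rfl⟩, hN⟩ := IsArtinian.set_has_minimal
    {N : Submodule R M | ∃ (n : ℕ) (f : M →ₗ[R] (Fin n → R)), LinearMap.ker f = N}
    ⟨_, 0, 0, rfl⟩
  refine ⟨n, f, LinearMap.ker_eq_bot.1 ?_⟩
  by_contra hne
  obtain ⟨x, hx, hx0⟩ := Submodule.exists_mem_ne_zero_of_ne_bot hne
  obtain ⟨g, hg⟩ := exists_linearMap_ne_zero (R := R) hx0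
  let k : M →ₗ[R] (Fin (n + 1) → R) :=
    LinearMap.pi (Fin.cons g fun i => LinearMap.proj i ∘ₗ f)
  have hk : ∀ y ∈ LinearMap.ker k, g y = 0 ∧ y ∈ LinearMap.ker f := fun y hy =>
    ⟨by simpa [k] using congrFun hy 0, by
      ext i
      simpa [k] using congrFun hy i.succ⟩
  refine hN _ ⟨n + 1, k, rfl⟩ (lt_of_le_of_ne (fun y hy => (hk y hy).2) fun h => ?_)
  exact hg (hk x (h ▸ hx)).1

end

/-! ### Non-projective simple modules -/

/-- If all simple modules over an artinian ring are projective, then the ring is semisimple. -/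
lemma IsSemisimpleRing.of_projective_simple (R : Type u) [Ring R]
    (h : ∀ (S : Type u) [AddCommGroup S] [Module R S], IsSimpleModule R S →
      Module.Projective R S) : IsSemisimpleRing R := by
  refine IsSemisimpleModule.of_sSup_simples_eq_top ?_
  by_contra hne
  obtain ⟨m, hm, hle⟩ := (eq_top_or_exists_le_coatom
    (sSup {N : Submodule R R | IsSimpleModule R N})).resolve_left hne
  have : IsSimpleModule R (R ⧸ m) := isSimpleModule_iff_isCoatom.2 hm
  have : Module.Projective R (R ⧸ m) := h _ this
  obtain ⟨s, hs⟩ := Module.projective_lifting_property m.mkQ LinearMap.id m.mkQ_surjective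
  have hsinj : Function.Injective s :=
    Function.LeftInverse.injective (g := m.mkQ) fun x => LinearMap.congr_fun hs x
  have hsimple : IsSimpleModule R (LinearMap.range s) :=
    IsSimpleModule.congr (LinearEquiv.ofInjective s hsinj).symm
  -- The image of the section is simple, so it lies in the socle and hence in `m`; the projection to
  -- `R ⧸ m` would then kill it.
  have hrange : LinearMap.range s ≤ m :=
    (le_sSup (a := LinearMap.range s) (s := {N : Submodule R R | IsSimpleModule R N})
      hsimple).trans hle
  have : Nontrivial (R ⧸ m) := IsSimpleModule.nontrivial R _
  obtain ⟨y, hy⟩ := exists_ne (0 : R ⧸ m)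
  apply hy
  have h1 : m.mkQ (s y) = 0 := (Submodule.Quotient.mk_eq_zero _).2 (hrange ⟨y, rfl⟩)
  rw [← h1]
  exact (LinearMap.congr_fun hs y).symm

lemma exists_simple_not_projective {R : Type u} [Ring R] (hR : globalDimension R = ⊤) :
    ∃ S : ModuleCat.{u} R, IsSimpleModule R S ∧ ¬ Module.Projective R S := by
  by_contra! H
  have : IsSemisimpleRing R :=
    IsSemisimpleRing.of_projective_simple R fun S _ _ hS => H (ModuleCat.of R S) hS
  have hle : globalDimension R ≤ 0 := by
    refine iSup_le fun M => ?_
    have : Projective M := (IsProjective.iff_projective _).1 (Module.projective_of_isSemisimpleRing R M)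
    have := (projectiveDimension_le_iff M 0).2 inferInstance
    simpa using this
  rw [hR] at hle
  exact absurd hle (by decide)

/-- By Schur's lemma a nonzero composite would be invertible, making `S` a direct summand of `P`. -/
lemma LinearMap.comp_eq_zero_of_simple_of_not_projective {R : Type u} [Ring R] {S P : Type u}
    [AddCommGroup S] [Module R S] [AddCommGroup P] [Module R P] [IsSimpleModule R S]
    [Module.Projective R P] (hS : ¬ Module.Projective R S) (f : S →ₗ[R] P) (g : P →ₗ[R] S) :
    g ∘ₗ f = 0 := by
  by_contra h
  let e := LinearEquiv.ofBijective _ (LinearMap.bijective_of_ne_zero h)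
  exact hS (Module.Projective.of_split f (e.symm.toLinearMap ∘ₗ g)
    (by ext x; exact e.symm_apply_apply x))

/-! ### Projective and injective objects of `mod R` -/

section

variable {R : Type u} [Ring R]

/-- The free module of rank `n` as an object of the category of finitely generated modules. -/
abbrev FGModuleCat.free (R : Type u) [Ring R] (n : ℕ) : FGModuleCat.{u} R :=
  FGModuleCat.of R (Fin n → R)

lemma FGModuleCat.exists_epi_free [IsNoetherianRing R] (M : FGModuleCat.{u} R) :
    ∃ (n : ℕ) (f : FGModuleCat.free R n ⟶ M), Epi f := by
  obtain ⟨n, f, hf⟩ := Module.Finite.exists_fin' R M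
  let φ : FGModuleCat.free R n ⟶ M := ObjectProperty.homMk (ModuleCat.ofHom f)
  exact ⟨n, φ, (modInclusion R).epi_of_epi_map ((ModuleCat.epi_iff_surjective _).2 hf)⟩

lemma FGModuleCat.exists_mono_free [IsQuasiFrobenius R] (M : FGModuleCat.{u} R) :
    ∃ (n : ℕ) (f : M ⟶ FGModuleCat.free R n), Mono f := by
  obtain ⟨n, f, hf⟩ := IsQuasiFrobenius.exists_injective_linearMap (R := R) M
  let φ : M ⟶ FGModuleCat.free R n := ObjectProperty.homMk (ModuleCat.ofHom f)
  exact ⟨n, φ, (modInclusion R).mono_of_mono_map ((ModuleCat.mono_iff_injective _).2 hf)⟩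

lemma FGModuleCat.projective_modInclusion_free (n : ℕ) :
    Projective ((modInclusion R).obj (FGModuleCat.free R n)) :=
  (IsProjective.iff_projective _).1 (inferInstanceAs (Module.Projective R (Fin n → R)))

lemma FGModuleCat.injective_modInclusion_free [IsQuasiFrobenius R] (n : ℕ) :
    Injective ((modInclusion R).obj (FGModuleCat.free R n)) :=
  (Module.injective_iff_injective_object R _).1
    (inferInstanceAs (Module.Injective R (Fin n → R)))

instance [IsNoetherianRing R] (n : ℕ) : Projective (FGModuleCat.free R n) :=
  (modInclusion R).projective_of_map_projective (FGModuleCat.projective_modInclusion_free n)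

instance [IsQuasiFrobenius R] (n : ℕ) : Injective (FGModuleCat.free R n) :=
  (modInclusion R).injective_of_map_injective (FGModuleCat.injective_modInclusion_free n)

instance [IsNoetherianRing R] : EnoughProjectives (FGModuleCat.{u} R) where
  presentation M := by
    obtain ⟨n, f, hf⟩ := FGModuleCat.exists_epi_free M
    exact ⟨{ p := FGModuleCat.free R n, f := f }⟩

instance [IsQuasiFrobenius R] : EnoughInjectives (FGModuleCat.{u} R) where
  presentation M := by
    obtain ⟨n, f, hf⟩ := FGModuleCat.exists_mono_free M
    exact ⟨{ J := FGModuleCat.free R n, f := f }⟩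

/-- A finitely generated module that is projective or injective as an object of the category of
finitely generated modules is a retract of a finitely generated free module. -/
lemma FGModuleCat.exists_retract_free [IsQuasiFrobenius R] (M : FGModuleCat.{u} R)
    (hM : Projective M ∨ Injective M) :
    ∃ n : ℕ, Nonempty (Retract M (FGModuleCat.free R n)) := by
  obtain hM | hM := hM
  · obtain ⟨n, f, hf⟩ := exists_epi_free M
    exact ⟨n, ⟨⟨Projective.factorThru (𝟙 M) f, f, by simp⟩⟩⟩
  · obtain ⟨n, f, hf⟩ := exists_mono_free M
    exact ⟨n, ⟨⟨f, Injective.factorThru (𝟙 M) f, by simp⟩⟩⟩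

/-- Lifting properties against finitely generated modules suffice for those against all modules,
because finitely generated free modules are projective and injective in `Mod R`. -/
lemma FGModuleCat.projective_and_injective_modInclusion [IsQuasiFrobenius R]
    (M : FGModuleCat.{u} R) (hM : Projective M ∨ Injective M) :
    Projective ((modInclusion R).obj M) ∧ Injective ((modInclusion R).obj M) := by
  obtain ⟨n, ⟨r⟩⟩ := exists_retract_free M hM
  have := projective_modInclusion_free (R := R) n
  have := injective_modInclusion_free (R := R) n
  exact ⟨(r.map (modInclusion R)).projective, (r.map (modInclusion R)).injective⟩

end

/-! ### Complete resolutions -/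

section

variable {C : Type*} [Category* C] [Abelian C] {S : C} (P : ProjectiveResolution S)
  (I : InjectiveResolution S)

/-- The augmentation of a projective resolution. -/
def CategoryTheory.ProjectiveResolution.augmentation : P.complex.X 0 ⟶ S := P.π.f 0

instance : Epi P.augmentation := inferInstanceAs (Epi (P.π.f 0))

lemma CategoryTheory.ProjectiveResolution.d_comp_augmentation :
    P.complex.d 1 0 ≫ P.augmentation = 0 := P.complex_d_comp_π_f_zero

/-- The coaugmentation of an injective resolution. -/
def CategoryTheory.InjectiveResolution.coaugmentation : S ⟶ I.cocomplex.X 0 := I.ι.f 0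

instance : Mono I.coaugmentation := inferInstanceAs (Mono (I.ι.f 0))

lemma CategoryTheory.InjectiveResolution.coaugmentation_comp_d :
    I.coaugmentation ≫ I.cocomplex.d 0 1 = 0 := I.ι_f_zero_comp_complex_d

/-- The data which connects a projective resolution and an injective resolution of an object into
an acyclic complex. -/
noncomputable def completeResolutionData :
    CochainComplex.ConnectData P.complex I.cocomplex where
  d₀ := P.augmentation ≫ I.coaugmentation
  comp_d₀ := by rw [← Category.assoc, P.d_comp_augmentation, zero_comp]
  d₀_comp := by rw [Category.assoc, I.coaugmentation_comp_d, comp_zero]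

/-- The complete resolution obtained by splicing a projective and an injective resolution. -/
noncomputable abbrev completeResolution : CochainComplex C ℤ :=
  (completeResolutionData P I).cochainComplex

/-- The term `P₀` sits in degree `-1` and `I⁰` in degree `0`. Only these two degrees need an
argument: the connecting map factors as an epi onto `S` followed by a mono, so it has the kernel of
the augmentation and the image of the coaugmentation. -/
lemma completeResolution_acyclic : (completeResolution P I).Acyclic := by
  rintro ((_ | n) | (_ | n))
  · change (completeResolution P I).ExactAt 0
    rw [HomologicalComplex.exactAt_iff' _ (-1) 0 1 (by simp) (by simp)]
    let φ : ShortComplex.mk (P.augmentation ≫ I.coaugmentation) (I.cocomplex.d 0 1)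
        (completeResolutionData P I).d₀_comp ⟶ ShortComplex.mk _ _ I.coaugmentation_comp_d :=
      { τ₁ := P.augmentation, τ₂ := 𝟙 _, τ₃ := 𝟙 _ }
    have : Epi φ.τ₁ := inferInstanceAs (Epi P.augmentation)
    have : IsIso φ.τ₂ := inferInstanceAs (IsIso (𝟙 _))
    have : Mono φ.τ₃ := inferInstanceAs (Mono (𝟙 _))
    exact (ShortComplex.exact_iff_of_epi_of_isIso_of_mono φ).2 I.exact₀
  · rw [HomologicalComplex.exactAt_iff_isZero_homology]
    exact (I.cocomplex_exactAt_succ n).isZero_homology.of_iso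
      ((completeResolutionData P I).homologyIsoPos (n + 1) _ rfl)
  · change (completeResolution P I).ExactAt (-1)
    rw [HomologicalComplex.exactAt_iff' _ (-2) (-1) 0 (by simp) (by simp)]
    let φ : ShortComplex.mk _ _ P.d_comp_augmentation ⟶
        ShortComplex.mk (P.complex.d 1 0) (P.augmentation ≫ I.coaugmentation)
          (completeResolutionData P I).comp_d₀ :=
      { τ₁ := 𝟙 _, τ₂ := 𝟙 _, τ₃ := I.coaugmentation }
    have : Epi φ.τ₁ := inferInstanceAs (Epi (𝟙 _))
    have : IsIso φ.τ₂ := inferInstanceAs (IsIso (𝟙 _))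
    have : Mono φ.τ₃ := inferInstanceAs (Mono I.coaugmentation)
    exact (ShortComplex.exact_iff_of_epi_of_isIso_of_mono φ).1 P.exact₀
  · rw [HomologicalComplex.exactAt_iff_isZero_homology]
    exact (P.complex_exactAt_succ n).isZero_homology.of_iso
      ((completeResolutionData P I).homologyIsoNeg (n + 1) _ (by simp [Int.negSucc_eq]))

end

/-- Every finitely generated module over a quasi-Frobenius ring is the cokernel of a differential
in an acyclic complex of finitely generated modules that are both projective and injective. -/
lemma IsQuasiFrobenius.exists_acyclic_complex {R : Type u} [Ring R] [IsQuasiFrobenius R]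
    (S : ModuleCat.{u} R) [Module.Finite R S] :
    ∃ T : CochainComplex (ModuleCat.{u} R) ℤ, T.Acyclic ∧ (∀ i, Module.Finite R (T.X i)) ∧
      (∀ i, Projective (T.X i)) ∧ (∀ i, Injective (T.X i)) ∧
      ∃ p : T.X (-1) →ₗ[R] S, Function.Surjective p ∧
        LinearMap.ker p = LinearMap.range (T.d (-2) (-1)).hom := by
  let S' : FGModuleCat.{u} R := FGModuleCat.of R S
  let P := ProjectiveResolution.of S'
  let I := InjectiveResolution.of S'
  let T₀ := completeResolution P I
  have hT₀ : ∀ i, Projective (T₀.X i) ∨ Injective (T₀.X i)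
    | .ofNat n => Or.inr (I.injective n)
    | .negSucc n => Or.inl (P.projective n)
  have hPI := fun i => FGModuleCat.projective_and_injective_modInclusion _ (hT₀ i)
  refine ⟨((modInclusion R).mapHomologicalComplex _).obj T₀, fun i => ?_, fun i => (T₀.X i).property,
    fun i => (hPI i).1, fun i => (hPI i).2,
    ((modInclusion R).map P.augmentation).hom, ?_, ?_⟩
  · exact (completeResolution_acyclic P I i).map (modInclusion R)
  · exact (ModuleCat.epi_iff_surjective _).1
      (inferInstanceAs (Epi ((modInclusion R).map P.augmentation)))
  · exact ((P.exact₀.map (modInclusion R)).moduleCat_range_eq_ker).symm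

/-! ### Direct sums with prescribed supports -/

section

open Classical in
/-- The linear map between spaces of finitely supported families that is induced by applying a
linear map componentwise and deleting the components outside a given set. -/
noncomputable def Finsupp.supportedMap {R M N α : Type*} [Ring R] [AddCommGroup M] [Module R M]
    [AddCommGroup N] [Module R N] (f : M →ₗ[R] N) (s t : Set α) :
    Finsupp.supported M R s →ₗ[R] Finsupp.supported N R t :=
  Finsupp.restrictDom N R t ∘ₗ Finsupp.mapRange.linearMap f ∘ₗ (Finsupp.supported M R s).subtype

variable {R M N α : Type*} [Ring R] [AddCommGroup M] [Module R M]
    [AddCommGroup N] [Module R N] (f : M →ₗ[R] N) {s t : Set α}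

lemma Finsupp.supportedMap_apply_of_mem (x : Finsupp.supported M R s) {a : α} (ha : a ∈ t) :
    (Finsupp.supportedMap f s t x).1 a = f (x.1 a) := by
  simp [supportedMap, restrictDom_apply, ha]

lemma Finsupp.supported_apply_of_notMem (x : Finsupp.supported M R s) {a : α} (ha : a ∉ s) :
    x.1 a = 0 :=
  (Finsupp.mem_supported' R x.1).1 x.2 a ha

lemma Finsupp.supported_ext {x y : Finsupp.supported M R s} (h : ∀ a ∈ s, x.1 a = y.1 a) :
    x = y := by
  refine Subtype.ext (Finsupp.ext fun a => ?_)
  by_cases ha : a ∈ s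
  · exact h a ha
  · rw [supported_apply_of_notMem x ha, supported_apply_of_notMem y ha]

lemma Finsupp.supportedMap_zero (s t : Set α) :
    Finsupp.supportedMap (0 : M →ₗ[R] N) s t = 0 :=
  LinearMap.ext fun x => supported_ext fun _ hn => supportedMap_apply_of_mem _ x hn

lemma Finsupp.supportedMap_comp_of_comp_eq_zero {L : Type*} [AddCommGroup L] [Module R L]
    (g : N →ₗ[R] L) (h : g ∘ₗ f = 0) (s t u : Set α) :
    Finsupp.supportedMap g t u ∘ₗ Finsupp.supportedMap f s t = 0 := by
  refine LinearMap.ext fun x => supported_ext fun n hn => ?_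
  rw [LinearMap.comp_apply, supportedMap_apply_of_mem _ _ hn]
  by_cases ht : n ∈ t
  · rw [supportedMap_apply_of_mem _ _ ht]
    exact LinearMap.congr_fun h (x.1 n)
  · rw [supported_apply_of_notMem _ ht, map_zero]
    rfl

lemma Finsupp.supportedMap_comp {L : Type*} [AddCommGroup L] [Module R L]
    (g : N →ₗ[R] L) (s t u : Set α) (h : s ∩ u ⊆ t) :
    Finsupp.supportedMap g t u ∘ₗ Finsupp.supportedMap f s t =
      Finsupp.supportedMap (g ∘ₗ f) s u := by
  refine LinearMap.ext fun x => supported_ext fun n hn => ?_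
  rw [LinearMap.comp_apply, supportedMap_apply_of_mem _ _ hn, supportedMap_apply_of_mem _ _ hn]
  by_cases ht : n ∈ t
  · rw [supportedMap_apply_of_mem _ _ ht]
    rfl
  · have hs : n ∉ s := fun hs => ht (h ⟨hs, hn⟩)
    rw [supported_apply_of_notMem _ ht, supported_apply_of_notMem _ hs, map_zero, map_zero]

lemma Finsupp.supportedMap_comp_of_disjoint {L : Type*} [AddCommGroup L] [Module R L]
    (g : N →ₗ[R] L) (s t u : Set α) (h : s ∩ t ∩ u = ∅) :
    Finsupp.supportedMap g t u ∘ₗ Finsupp.supportedMap f s t = 0 := by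
  refine LinearMap.ext fun x => supported_ext fun n hn => ?_
  rw [LinearMap.comp_apply, supportedMap_apply_of_mem _ _ hn]
  by_cases ht : n ∈ t
  · have hs : n ∉ s := fun hs => (h ▸ ⟨⟨hs, ht⟩, hn⟩ : n ∈ (∅ : Set α))
    rw [supportedMap_apply_of_mem _ _ ht, supported_apply_of_notMem _ hs, map_zero, map_zero]
    rfl
  · rw [supported_apply_of_notMem _ ht, map_zero]
    rfl

/-- Only components in `s ∩ t'` matter. On these, one side of the square survives exactly when `a ∈
s'`, the other exactly when `a ∈ t`. -/
lemma Finsupp.supportedMap_comm_id {s t s' t' : Set α}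
    (h : ∀ a, a ∈ s → a ∈ t' → (a ∈ s' ↔ a ∈ t)) :
    Finsupp.supportedMap f s' t' ∘ₗ Finsupp.supportedMap LinearMap.id s s' =
      Finsupp.supportedMap LinearMap.id t t' ∘ₗ Finsupp.supportedMap f s t := by
  refine LinearMap.ext fun x => supported_ext fun n hn => ?_
  rw [LinearMap.comp_apply, LinearMap.comp_apply, supportedMap_apply_of_mem _ _ hn,
    supportedMap_apply_of_mem _ _ hn]
  by_cases hs : n ∈ s
  · by_cases hs' : n ∈ s'
    · rw [supportedMap_apply_of_mem _ _ hs', supportedMap_apply_of_mem _ _ ((h n hs hn).1 hs')]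
      rfl
    · rw [supported_apply_of_notMem _ hs',
        supported_apply_of_notMem _ fun H => hs' ((h n hs hn).2 H), map_zero, map_zero]
  · have hx : x.1 n = 0 := supported_apply_of_notMem x hs
    have h₁ : (supportedMap LinearMap.id s s' x).1 n = 0 := by
      by_cases hs' : n ∈ s'
      · rw [supportedMap_apply_of_mem _ _ hs', hx, map_zero]
      · exact supported_apply_of_notMem _ hs'
    have h₂ : (supportedMap f s t x).1 n = 0 := by
      by_cases ht : n ∈ t
      · rw [supportedMap_apply_of_mem _ _ ht, hx, map_zero]
      · exact supported_apply_of_notMem _ ht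
    rw [h₁, h₂, map_zero, map_zero]

lemma Finsupp.supportedMap_id (s : Set α) :
    Finsupp.supportedMap (LinearMap.id : M →ₗ[R] M) s s = LinearMap.id :=
  LinearMap.ext fun x => supported_ext fun _ hn => supportedMap_apply_of_mem _ x hn

lemma Finsupp.supportedMap_id_injective (h : s ⊆ t) :
    Function.Injective (Finsupp.supportedMap (LinearMap.id : M →ₗ[R] M) s t) := by
  have := supportedMap_comp (LinearMap.id : M →ₗ[R] M) LinearMap.id s t s (fun _ hx => h hx.1)
  rw [LinearMap.comp_id, supportedMap_id] at this
  exact Function.LeftInverse.injective (g := supportedMap LinearMap.id t s)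
    fun x => LinearMap.congr_fun this x

lemma Finsupp.supportedMap_id_surjective (h : t ⊆ s) :
    Function.Surjective (Finsupp.supportedMap (LinearMap.id : M →ₗ[R] M) s t) := by
  have := supportedMap_comp (LinearMap.id : M →ₗ[R] M) LinearMap.id t s t (fun _ hx => h hx.1)
  rw [LinearMap.comp_id, supportedMap_id] at this
  exact Function.RightInverse.surjective (g := supportedMap LinearMap.id t s)
    fun x => LinearMap.congr_fun this x

lemma Finsupp.supportedMap_id_exact {u : Set α} (hst : s ∩ u = ∅) (htu : t ⊆ s ∪ u) :
    Function.Exact (Finsupp.supportedMap (LinearMap.id : M →ₗ[R] M) s t)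
      (Finsupp.supportedMap (LinearMap.id : M →ₗ[R] M) t u) := by
  intro x
  constructor
  · intro hx
    refine ⟨Finsupp.supportedMap LinearMap.id t s x, supported_ext fun n hn => ?_⟩
    rw [supportedMap_apply_of_mem _ _ hn]
    by_cases hs : n ∈ s
    · rw [supportedMap_apply_of_mem _ _ hs]
      rfl
    · have hu := supportedMap_apply_of_mem LinearMap.id x ((htu hn).resolve_left hs)
      rw [hx] at hu
      rw [supported_apply_of_notMem _ hs, map_zero]
      exact hu
  · rintro ⟨y, rfl⟩
    exact LinearMap.congr_fun (supportedMap_comp_of_disjoint LinearMap.id LinearMap.id s t u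
      (Set.eq_empty_of_forall_notMem fun a ha => (hst ▸ ⟨ha.1.1, ha.2⟩ : a ∈ (∅ : Set α)))) y

lemma Finsupp.supportedMap_exact {L : Type*} [AddCommGroup L] [Module R L] {g : N →ₗ[R] L}
    (h : Function.Exact f g) (s : Set α) :
    Function.Exact (Finsupp.supportedMap f s s) (Finsupp.supportedMap g s s) := by
  intro x
  constructor
  · intro hx
    -- Zero must be lifted to zero, so that the chosen preimages have finite support.
    have H : ∀ n, ∃ y, f y = x.1 n ∧ (x.1 n = 0 → y = 0) := by
      intro n
      by_cases hn : n ∈ s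
      · have := supportedMap_apply_of_mem g x hn
        rw [hx] at this
        obtain ⟨y, hy⟩ := (h (x.1 n)).1 this.symm
        by_cases h0 : x.1 n = 0
        · exact ⟨0, by simp [h0], fun _ => rfl⟩
        · exact ⟨y, hy, fun h => absurd h h0⟩
      · exact ⟨0, by rw [supported_apply_of_notMem x hn, map_zero], fun _ => rfl⟩
    choose y hy hy0 using H
    let z : α →₀ M := Finsupp.onFinset x.1.support y fun a ha => by
      rw [Finsupp.mem_support_iff]
      exact fun h => ha (hy0 a h)
    have hz : z ∈ Finsupp.supported M R s :=
      (Finsupp.mem_supported' R z).2 fun a ha => hy0 a (supported_apply_of_notMem x ha)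
    exact ⟨⟨z, hz⟩, supported_ext fun n hn => by
      rw [supportedMap_apply_of_mem _ _ hn]; exact hy n⟩
  · rintro ⟨y, rfl⟩
    exact LinearMap.congr_fun
      (supportedMap_comp_of_comp_eq_zero f g h.linearMap_comp_eq_zero s s s) y

lemma Finsupp.finite_supported [Module.Finite R M] (hs : s.Finite) :
    Module.Finite R (Finsupp.supported M R s) :=
  have := hs.to_subtype
  Module.Finite.equiv (Finsupp.supportedEquivFinsupp s).symm

lemma Finsupp.projective_supported [Module.Projective R M] :
    Module.Projective R (Finsupp.supported M R s) := by
  classical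
  exact Module.Projective.of_equiv
    ((Finsupp.supportedEquivFinsupp s).trans (finsuppLequivDFinsupp R)).symm

end

lemma Finsupp.injective_supported {R M : Type u} {α : Type} [Ring R] [AddCommGroup M]
    [Module R M] [Module.Injective R M] {s : Set α} (hs : s.Finite) :
    Module.Injective R (Finsupp.supported M R s) :=
  have := hs.to_subtype
  have : Module.Injective R (s → M) := inferInstance
  let e : (s → M) ≃ₗ[R] Finsupp.supported M R s :=
    ((Finsupp.supportedEquivFinsupp s).trans (Finsupp.linearEquivFunOnFinite R M s)).symm
  Module.Baer.injective (Module.Baer.of_equiv e (Module.Baer.of_injective this))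

/-! ### Direct sums of brutal truncations -/

namespace CochainComplex

variable {R : Type u} [Ring R] (T : CochainComplex (ModuleCat.{u} R) ℤ)

/-- The direct sum, over `n : ℕ`, of the complexes that agree with `T` in the degrees `i` such that
`P n i` holds and are zero in the other degrees. -/
noncomputable def sumCut (P : ℕ → ℤ → Prop) : CochainComplex (ModuleCat.{u} R) ℤ where
  X i := ModuleCat.of R (Finsupp.supported (T.X i) R {n | P n i})
  d i j := ModuleCat.ofHom (Finsupp.supportedMap (T.d i j).hom {n | P n i} {n | P n j})
  shape i j hij := by
    rw [T.shape i j hij]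
    exact ModuleCat.hom_ext (Finsupp.supportedMap_zero _ _)
  d_comp_d' i j k _ _ := ModuleCat.hom_ext (Finsupp.supportedMap_comp_of_comp_eq_zero _ _
    (congrArg ModuleCat.Hom.hom (T.d_comp_d i j k)) _ _ _)

variable (P P' P'' : ℕ → ℤ → Prop)

/-- The morphism between direct sums of truncations of `T` that is the identity wherever this makes
sense. -/
noncomputable def sumCutMap
    (h : ∀ n i, P n i → P' n (i + 1) → (P' n i ↔ P n (i + 1))) : T.sumCut P ⟶ T.sumCut P' where
  f i := ModuleCat.ofHom (Finsupp.supportedMap LinearMap.id {n | P n i} {n | P' n i})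
  comm' i j hij := by
    obtain rfl : i + 1 = j := hij
    exact ModuleCat.hom_ext (Finsupp.supportedMap_comm_id _ fun n => h n i)

variable {T P P' P''}

lemma sumCutMap_comp_of_subset (h h') (hP : ∀ n i, P n i → P' n i) :
    T.sumCutMap P P' h ≫ T.sumCutMap P' P h' = 𝟙 _ := by
  ext i : 1
  exact ModuleCat.hom_ext ((Finsupp.supportedMap_comp _ _ _ _ _ fun n hn => hP n i hn.1).trans
    (by rw [LinearMap.comp_id]; exact Finsupp.supportedMap_id _))

lemma sumCutMap_comp_of_disjoint (h h') (hP : ∀ n i, P n i → P' n i → ¬ P'' n i) :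
    T.sumCutMap P P' h ≫ T.sumCutMap P' P'' h' = 0 := by
  ext i : 1
  exact ModuleCat.hom_ext (Finsupp.supportedMap_comp_of_disjoint _ _ _ _ _
    (Set.eq_empty_of_forall_notMem fun n hn => hP n i hn.1.1 hn.1.2 hn.2))

/-- Given the inclusions, `h` says that `P` is closed under raising the degree within `P'`, and `h'`
that `P''` is closed under lowering it. Thus `P` cuts out a subcomplex with quotient `P''`. -/
lemma sumCut_shortExact (h h') (hdisj : ∀ n i, P n i → ¬ P'' n i)
    (hP : ∀ n i, P n i → P' n i) (hP'' : ∀ n i, P'' n i → P' n i)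
    (hP' : ∀ n i, P' n i → P n i ∨ P'' n i) :
    (ShortComplex.mk (T.sumCutMap P P' h) (T.sumCutMap P' P'' h')
      (sumCutMap_comp_of_disjoint h h' fun n i h _ => hdisj n i h)).ShortExact := by
  refine HomologicalComplex.shortExact_of_degreewise_shortExact _ fun i => ?_
  refine ShortComplex.ShortExact.mk' ?_ ?_ ?_
  · refine (ShortComplex.ShortExact.moduleCat_exact_iff_function_exact _).2 ?_
    exact Finsupp.supportedMap_id_exact
      (Set.eq_empty_of_forall_notMem fun n hn => hdisj n i hn.1 hn.2) (fun n hn => hP' n i hn)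
  · exact (ModuleCat.mono_iff_injective _).2
      (Finsupp.supportedMap_id_injective fun n hn => hP n i hn)
  · exact (ModuleCat.epi_iff_surjective _).2
      (Finsupp.supportedMap_id_surjective fun n hn => hP'' n i hn)

lemma sumCut_acyclic (hT : T.Acyclic) : (T.sumCut fun _ _ => True).Acyclic := by
  intro i
  rw [HomologicalComplex.exactAt_iff' _ (i - 1) i (i + 1) (by simp) (by simp)]
  refine (ShortComplex.ShortExact.moduleCat_exact_iff_function_exact _).2 ?_
  have := hT i
  rw [HomologicalComplex.exactAt_iff' _ (i - 1) i (i + 1) (by simp) (by simp),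
    ShortComplex.ShortExact.moduleCat_exact_iff_function_exact] at this
  exact Finsupp.supportedMap_exact _ this _

lemma finite_sumCut_X (i : ℤ) [Module.Finite R (T.X i)] (h : {n | P n i}.Finite) :
    Module.Finite R ((T.sumCut P).X i) :=
  Finsupp.finite_supported h

lemma isZero_sumCut_X (i : ℤ) (h : ∀ n, ¬ P n i) : IsZero ((T.sumCut P).X i) := by
  have : Subsingleton ((T.sumCut P).X i) :=
    ⟨fun _ _ => Finsupp.supported_ext fun n hn => absurd hn (h n)⟩
  exact ModuleCat.isZero_of_subsingleton _

lemma projective_sumCut_X (i : ℤ) [Projective (T.X i)] : Projective ((T.sumCut P).X i) := by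
  have : Module.Projective R (T.X i) := (IsProjective.iff_projective _).2 inferInstance
  exact (IsProjective.iff_projective _).1 Finsupp.projective_supported

lemma injective_sumCut_X (i : ℤ) [Injective (T.X i)] (h : {n | P n i}.Finite) :
    Injective ((T.sumCut P).X i) := by
  have : Module.Injective R (T.X i) := (Module.injective_iff_injective_object _ _).2 inferInstance
  exact (Module.injective_iff_injective_object _ _).1 (Finsupp.injective_supported h)

lemma isKProjective_sumCut [∀ i, Projective (T.X i)] (b : ℤ) (h : ∀ n i, P n i → i ≤ b) :
    (T.sumCut P).IsKProjective := by
  have : (T.sumCut P).IsStrictlyLE b := by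
    rw [isStrictlyLE_iff]
    exact fun i hi => isZero_sumCut_X i fun n hn => by have := h n i hn; lia
  have (i : ℤ) : Projective ((T.sumCut P).X i) := projective_sumCut_X i
  exact isKProjective_of_projective _ b

lemma isKInjective_sumCut [∀ i, Injective (T.X i)] (a : ℤ) (h : ∀ n i, P n i → a ≤ i)
    (hfin : ∀ i, {n | P n i}.Finite) : (T.sumCut P).IsKInjective := by
  have : (T.sumCut P).IsStrictlyGE a := by
    rw [isStrictlyGE_iff]
    exact fun i hi => isZero_sumCut_X i fun n hn => by have := h n i hn; lia
  have (i : ℤ) : Injective ((T.sumCut P).X i) := injective_sumCut_X i (hfin i)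
  exact isKInjective_of_injective _ a

end CochainComplex

/-! ### Representing morphisms of the derived category by chain maps -/

namespace DerivedCategory

variable {C : Type*} [Category* C] [Abelian C] [HasDerivedCategory C]

lemma Q_map_surjective_of_isKProjective (K L : CochainComplex C ℤ) [K.IsKProjective] :
    Function.Surjective (Q.map : (K ⟶ L) → _) := by
  intro f
  obtain ⟨g, hg⟩ := (CochainComplex.IsKProjective.Qh_map_bijective K
    ((HomotopyCategory.quotient _ _).obj L)).surjective
      ((quotientCompQhIso C).hom.app K ≫ f ≫ (quotientCompQhIso C).inv.app L)
  obtain ⟨g, rfl⟩ := (HomotopyCategory.quotient _ _).map_surjective g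
  refine ⟨g, ?_⟩
  have := (quotientCompQhIso C).hom.naturality g
  rw [Functor.comp_map, hg] at this
  simpa using this.symm

lemma Q_map_surjective_of_isKInjective (K L : CochainComplex C ℤ) [L.IsKInjective] :
    Function.Surjective (Q.map : (K ⟶ L) → _) := by
  intro f
  obtain ⟨g, hg⟩ := (CochainComplex.IsKInjective.Qh_map_bijective
    ((HomotopyCategory.quotient _ _).obj K) L).surjective
      ((quotientCompQhIso C).hom.app K ≫ f ≫ (quotientCompQhIso C).inv.app L)
  obtain ⟨g, rfl⟩ := (HomotopyCategory.quotient _ _).map_surjective g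
  refine ⟨g, ?_⟩
  have := (quotientCompQhIso C).hom.naturality g
  rw [Functor.comp_map, hg] at this
  simpa using this.symm

lemma nonempty_homotopy_of_Q_map_eq {K L : CochainComplex C ℤ} [K.IsKProjective]
    {f g : K ⟶ L} (h : Q.map f = Q.map g) : Nonempty (Homotopy f g) := by
  refine ⟨HomotopyCategory.homotopyOfEq _ _
    ((CochainComplex.IsKProjective.Qh_map_bijective K _).injective ?_)⟩
  have hf := (quotientCompQhIso C).hom.naturality f
  have hg := (quotientCompQhIso C).hom.naturality g
  rw [h, ← hg] at hf
  exact (cancel_mono _).1 hf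

end DerivedCategory

/-! ### The noetherian obstruction to being a retract -/

lemma LinearMap.exists_comp_eq_of_ker_le {R M N L : Type*} [Ring R] [AddCommGroup M] [Module R M]
    [AddCommGroup N] [Module R N] [AddCommGroup L] [Module R L] {p : M →ₗ[R] N}
    (hp : Function.Surjective p) {f : M →ₗ[R] L} (h : LinearMap.ker p ≤ LinearMap.ker f) :
    ∃ g : N →ₗ[R] L, g ∘ₗ p = f := by
  refine ⟨(LinearMap.ker p).liftQ f h ∘ₗ (p.quotKerEquivOfSurjective hp).symm.toLinearMap, ?_⟩
  ext x
  have : (p.quotKerEquivOfSurjective hp).symm (p x) = (LinearMap.ker p).mkQ x := by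
    rw [LinearEquiv.symm_apply_eq]
    rfl
  change (LinearMap.ker p).liftQ f h ((p.quotKerEquivOfSurjective hp).symm (p x)) = f x
  rw [this]
  rfl

/-- A noetherian module does not contain infinitely many independent copies of a nonzero module. -/
lemma IsNoetherian.false_of_biorthogonal {R Z S : Type*} [Ring R] [AddCommGroup Z] [Module R Z]
    [IsNoetherian R Z] [AddCommGroup S] [Module R S] [Nontrivial S] (a : ℕ → S →ₗ[R] Z)
    (b : ℕ → Z →ₗ[R] S) (hab : ∀ n, b n ∘ₗ a n = LinearMap.id)
    (hab' : ∀ n m, n ≠ m → b m ∘ₗ a n = 0) : False := by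
  let W : ℕ →o Submodule R Z :=
    { toFun := fun n => ⨆ k : Fin n, LinearMap.range (a k)
      monotone' := fun n m h => iSup_le fun k =>
        le_iSup (fun k : Fin m => LinearMap.range (a k)) (Fin.castLE h k) }
  obtain ⟨n, hn⟩ := monotone_stabilizes_iff_noetherian.2 ‹_› W
  obtain ⟨x, hx⟩ := exists_ne (0 : S)
  -- `W` stabilizes at `n`, so `W n` contains the image of `a n`; but `b n` kills `W n` and is
  -- injective on that image.
  have hle : W n ≤ LinearMap.ker (b n) := iSup_le fun k => by
    rw [LinearMap.range_le_ker_iff]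
    exact hab' k n k.2.ne
  have hmem : a n x ∈ W n := by
    rw [hn (n + 1) n.le_succ]
    exact (le_iSup (fun k : Fin (n + 1) => LinearMap.range (a k)) (Fin.last n)) ⟨x, rfl⟩
  have : b n (a n x) = 0 := hle hmem
  rw [← LinearMap.comp_apply, hab] at this
  exact hx this

namespace CochainComplex

variable {R : Type u} [Ring R] {T : CochainComplex (ModuleCat.{u} R) ℤ}
  {P : ℕ → ℤ → Prop}

/-- The inclusion of the component of index `n` of `T.sumCut P` in degree `i`. -/
noncomputable def ιSumCut (n : ℕ) (i : ℤ) (h : P n i) : T.X i ⟶ (T.sumCut P).X i :=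
  ModuleCat.ofHom ((Finsupp.lsingle n).codRestrict (Finsupp.supported (T.X i) R {n | P n i})
    fun x => Finsupp.single_mem_supported R x h)

/-- The projection to the component of index `n` of `T.sumCut P` in degree `i`. -/
noncomputable def πSumCut (n : ℕ) (i : ℤ) : (T.sumCut P).X i ⟶ T.X i :=
  ModuleCat.ofHom (Finsupp.lapply n ∘ₗ (Finsupp.supported (T.X i) R {n | P n i}).subtype)

lemma ιSumCut_comp_d (n : ℕ) (i j : ℤ) (hi : P n i) (hj : P n j) :
    ιSumCut n i hi ≫ (T.sumCut P).d i j = T.d i j ≫ ιSumCut n j hj := by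
  refine ModuleCat.hom_ext (LinearMap.ext fun x => Finsupp.supported_ext fun m hm => ?_)
  refine (Finsupp.supportedMap_apply_of_mem _ _ hm).trans ?_
  change (T.d i j).hom (Finsupp.single n x m) = Finsupp.single n ((T.d i j).hom x) m
  by_cases h : n = m
  · subst h; simp
  · rw [Finsupp.single_eq_of_ne (Ne.symm h), Finsupp.single_eq_of_ne (Ne.symm h), map_zero]

lemma d_comp_πSumCut (n : ℕ) (i j : ℤ) (hj : P n j) :
    (T.sumCut P).d i j ≫ πSumCut n j = πSumCut n i ≫ T.d i j :=
  ModuleCat.hom_ext (LinearMap.ext fun _ => Finsupp.supportedMap_apply_of_mem _ _ hj)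

lemma ιSumCut_comp_πSumCut (n : ℕ) (i : ℤ) (h : P n i) :
    ιSumCut n i h ≫ (πSumCut n i : (T.sumCut P).X i ⟶ T.X i) = 𝟙 _ :=
  ModuleCat.hom_ext (LinearMap.ext fun x => Finsupp.single_eq_same (a := n) (b := x))

/-- If all the complexes `T.sumCut (P n)` are retracts up to homotopy, in an orthogonal way, of the
same complex `X`, then the modules of `X` are not noetherian. -/
lemma false_of_homotopy_sumCut {S : ModuleCat.{u} R} [IsSimpleModule R S]
    (hS : ¬ Module.Projective R S) [∀ i, Projective (T.X i)]
    (p : T.X (-1) →ₗ[R] S) (hp : Function.Surjective p)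
    (hpd : LinearMap.ker p = LinearMap.range (T.d (-2) (-1)).hom)
    (P : ℕ → ℕ → ℤ → Prop) (hP₂ : ∀ n, P n n (-2)) (hP₁ : ∀ n, P n n (-1)) (hP₀ : ∀ n, P n n 0)
    (X : CochainComplex (ModuleCat.{u} R) ℤ) [IsNoetherian R (X.X (-1))]
    (a : ∀ n, T.sumCut (P n) ⟶ X) (b : ∀ n, X ⟶ T.sumCut (P n))
    (hab : ∀ n, Nonempty (Homotopy (a n ≫ b n) (𝟙 _)))
    (hab' : ∀ n m, n ≠ m → Nonempty (Homotopy (a n ≫ b m) 0)) : False := by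
  let Z := X.X (-1) ⧸ LinearMap.range (X.d (-2) (-1)).hom
  let π : X.X (-1) →ₗ[R] Z := Submodule.mkQ _
  let p' : T.X (-1) ⟶ S := ModuleCat.ofHom p
  have hdp : T.d (-2) (-1) ≫ p' = 0 :=
    ModuleCat.hom_ext (LinearMap.range_le_ker_iff.1 hpd.ge)
  have hp' : Epi p' := (ModuleCat.epi_iff_surjective _).2 hp
  have hdesc {L : ModuleCat.{u} R} (f : T.X (-1) ⟶ L) (hf : T.d (-2) (-1) ≫ f = 0) :
      ∃ g : S ⟶ L, p' ≫ g = f := by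
    obtain ⟨g, hg⟩ := LinearMap.exists_comp_eq_of_ker_le hp (f := f.hom)
      (hpd.le.trans (LinearMap.range_le_ker_iff.2 (congrArg ModuleCat.Hom.hom hf)))
    exact ⟨ModuleCat.ofHom g, ModuleCat.hom_ext hg⟩
  let π' : X.X (-1) ⟶ ModuleCat.of R Z := ModuleCat.ofHom π
  have hπ' : X.d (-2) (-1) ≫ π' = 0 := ModuleCat.hom_ext (LinearMap.range_mkQ_comp _)
  have hα (n : ℕ) : ∃ α : S ⟶ ModuleCat.of R Z,
      p' ≫ α = ιSumCut n (-1) (hP₁ n) ≫ (a n).f (-1) ≫ π' := by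
    refine hdesc _ ?_
    rw [← Category.assoc, ← ιSumCut_comp_d n _ _ (hP₂ n), Category.assoc, ← (a n).comm_assoc,
      hπ', comp_zero, comp_zero]
  have hd (m : ℕ) :
      (T.sumCut (P m)).d (-2) (-1) ≫ (πSumCut m (-1) : _ ⟶ T.X (-1)) ≫ p' = 0 := by
    rw [← Category.assoc, d_comp_πSumCut m _ _ (hP₁ m), Category.assoc, hdp, comp_zero]
  have hβ (m : ℕ) : ∃ β : ModuleCat.of R Z ⟶ S,
      π' ≫ β = (b m).f (-1) ≫ πSumCut m (-1) ≫ p' := by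
    have h₀ : X.d (-2) (-1) ≫ (b m).f (-1) ≫ πSumCut m (-1) ≫ p' = 0 := by
      rw [← (b m).comm_assoc, hd, comp_zero]
    exact ⟨ModuleCat.ofHom (Submodule.liftQ _ ((b m).f (-1) ≫ πSumCut m (-1) ≫ p').hom
      (LinearMap.range_le_ker_iff.2 (congrArg ModuleCat.Hom.hom h₀))), ModuleCat.hom_ext rfl⟩
  choose α hα using hα
  choose β hβ using hβ
  have key (n m : ℕ) (g : T.sumCut (P n) ⟶ T.sumCut (P m)) (hg : Homotopy (a n ≫ b m) g) :
      p' ≫ α n ≫ β m = ιSumCut n (-1) (hP₁ n) ≫ g.f (-1) ≫ πSumCut m (-1) ≫ p' := by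
    -- The homotopy contributes two terms. The one ending in `d : -2 → -1` dies in `S`. The one
    -- starting with `d : -1 → 0` factors through `S` via `j`, and is then an endomorphism of `S`
    -- through the projective module in degree `0`.
    obtain ⟨j, hj⟩ := hdesc (T.d (-1) 0 ≫ ιSumCut n 0 (hP₀ n)) (by simp)
    have h₁ := hg.comm (-1)
    rw [dNext_eq _ (show (ComplexShape.up ℤ).Rel (-1) 0 by simp),
      prevD_eq _ (show (ComplexShape.up ℤ).Rel (-2) (-1) by simp)] at h₁
    have h₂ : j ≫ hg.hom 0 (-1) ≫ πSumCut m (-1) ≫ p' = 0 := by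
      have := projective_sumCut_X (T := T) (P := P n) 0
      have : Module.Projective R ((T.sumCut (P n)).X 0) :=
        (IsProjective.iff_projective _).2 inferInstance
      exact ModuleCat.hom_ext (LinearMap.comp_eq_zero_of_simple_of_not_projective hS j.hom
        (hg.hom 0 (-1) ≫ πSumCut m (-1) ≫ p').hom)
    have h₃ : ιSumCut n (-1) (hP₁ n) ≫ (T.sumCut (P n)).d (-1) 0 = p' ≫ j := by
      rw [hj, ιSumCut_comp_d n _ _ _ (hP₀ n)]
    calc p' ≫ α n ≫ β m
        = ιSumCut n (-1) (hP₁ n) ≫ (a n ≫ b m).f (-1) ≫ πSumCut m (-1) ≫ p' := by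
          rw [← Category.assoc, hα, Category.assoc, Category.assoc, hβ,
            HomologicalComplex.comp_f, Category.assoc]
      _ = _ := by
          rw [h₁]
          simp only [Preadditive.add_comp, Preadditive.comp_add, Category.assoc]
          rw [hd, comp_zero, comp_zero, add_zero, ← Category.assoc, h₃, Category.assoc, h₂,
            comp_zero, zero_add]
  have : Nontrivial S := IsSimpleModule.nontrivial R S
  refine IsNoetherian.false_of_biorthogonal (R := R) (Z := Z) (S := S) (fun n => (α n).hom)
    (fun n => (β n).hom) (fun n => ?_) fun n m hnm => ?_
  · obtain ⟨h⟩ := hab n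
    have : α n ≫ β n = 𝟙 _ := by
      rw [← cancel_epi p', key n n _ h, HomologicalComplex.id_f, Category.id_comp,
        ← Category.assoc, ιSumCut_comp_πSumCut, Category.id_comp, Category.comp_id]
    exact congrArg ModuleCat.Hom.hom this
  · obtain ⟨h⟩ := hab' n m hnm
    have : α n ≫ β m = 0 := by
      rw [← cancel_epi p', key n m _ h]
      simp
    exact congrArg ModuleCat.Hom.hom this

end CochainComplex

/-! ### Essential image and finitely generated cohomology -/

section

open DerivedCategory Pretriangulated

/-- The zero endomorphism of an acyclic complex is a quasi-isomorphism, hence invertible after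
localization. -/
lemma DerivedCategory.isZero_Q_obj_of_acyclic {C : Type*} [Category* C] [Abelian C]
    [HasDerivedCategory C] {K : CochainComplex C ℤ} (hK : K.Acyclic) : IsZero (Q.obj K) := by
  have : QuasiIso (0 : K ⟶ K) := ⟨fun i => by
    rw [quasiIsoAt_iff_isIso_homologyMap]
    exact (hK i).isZero_homology.isIso (hK i).isZero_homology _⟩
  have h : IsIso (Q.map (0 : K ⟶ K)) := (isIso_Q_map_iff_quasiIso _ _).2 this
  rw [Functor.map_zero] at h
  exact (IsZero.iff_id_eq_zero _).2 ((cancel_mono (0 : Q.obj K ⟶ Q.obj K)).1 (by simp))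

variable {R : Type u} [Ring R]

lemma mem_essImage_derivedModInclusion [IsNoetherianRing R]
    [HasDerivedCategory.{w₁} (FGModuleCat.{u} R)] [HasDerivedCategory.{w₂} (ModuleCat.{u} R)]
    (K : CochainComplex (ModuleCat.{u} R) ℤ) (hK : ∀ i, Module.Finite R (K.X i)) :
    (derivedModInclusion R).essImage (Q.obj K) := by
  let K₀ : CochainComplex (FGModuleCat.{u} R) ℤ :=
    { X := fun i => ⟨K.X i, hK i⟩
      d := fun i j => ObjectProperty.homMk (K.d i j)
      shape := fun i j hij => ObjectProperty.hom_ext _ (K.shape i j hij)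
      d_comp_d' := fun i j k _ _ => ObjectProperty.hom_ext _ (K.d_comp_d i j k) }
  let e : ((modInclusion R).mapHomologicalComplex (ComplexShape.up ℤ)).obj K₀ ≅ K :=
    HomologicalComplex.Hom.isoOfComponents (fun i => Iso.refl (K.X i)) fun i j _ =>
      (Category.id_comp _).trans (Category.comp_id _).symm
  exact ⟨Q.obj K₀, ⟨(modInclusion R).mapDerivedCategoryFactors.app K₀ ≪≫ Q.mapIso e⟩⟩

lemma essImage_derivedModInclusion_iff [IsNoetherianRing R]
    [HasDerivedCategory.{w₁} (FGModuleCat.{u} R)] [HasDerivedCategory.{w₂} (ModuleCat.{u} R)]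
    (Y : DerivedCategory (ModuleCat.{u} R)) :
    (derivedModInclusion R).essImage Y ↔ ∃ K : CochainComplex (ModuleCat.{u} R) ℤ,
      (∀ i, Module.Finite R (K.X i)) ∧ Nonempty (Y ≅ Q.obj K) := by
  constructor
  · rintro ⟨X, ⟨e⟩⟩
    exact ⟨((modInclusion R).mapHomologicalComplex (ComplexShape.up ℤ)).obj (Q.objPreimage X),
      fun i => ((Q.objPreimage X).X i).property,
      ⟨e.symm ≪≫ (derivedModInclusion R).mapIso (Q.objObjPreimageIso X).symm ≪≫
        (modInclusion R).mapDerivedCategoryFactors.app _⟩⟩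
  · rintro ⟨K, hK, ⟨e⟩⟩
    exact (derivedModInclusion R).essImage.prop_of_iso e.symm
      (mem_essImage_derivedModInclusion K hK)

section

variable [HasDerivedCategory.{w₂} (ModuleCat.{u} R)]

instance : (hasFGCohomology R).IsStableUnderRetracts where
  of_retract {X Y} r hY n := by
    have : Module.Finite R ((homologyFunctor (ModuleCat.{u} R) n).obj Y) := hY n
    let r' := r.map (homologyFunctor (ModuleCat.{u} R) n)
    exact Module.Finite.of_surjective r'.r.hom
      ((ModuleCat.epi_iff_surjective _).1 inferInstance)

instance : (hasFGCohomology R).IsClosedUnderIsomorphisms where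
  of_iso e hX := (hasFGCohomology R).prop_of_retract (Retract.ofIso e.symm) hX

/-- For triangles, the long exact sequence places each middle cohomology module between two
noetherian ones. -/
instance [IsNoetherianRing R] : (hasFGCohomology R).IsTriangulated where
  isStableUnderShiftBy a :=
    { le_shift := fun X hX n => by
        have : Module.Finite R ((homologyFunctor (ModuleCat.{u} R) (n + a)).obj X) := hX (n + a)
        let e : (homologyFunctor (ModuleCat.{u} R) (n + a)).obj X ≅
            (homologyFunctor (ModuleCat.{u} R) n).obj (X⟦a⟧) :=
          (((homologyFunctor (ModuleCat.{u} R) 0).shiftIso a n (n + a) (add_comm _ _)).app X).symm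
        exact Module.Finite.equiv e.toLinearEquiv }
  exists_zero := ⟨_, isZero_zero _, fun n => by
    have := ModuleCat.subsingleton_of_isZero
      ((homologyFunctor (ModuleCat.{u} R) n).map_isZero (isZero_zero _))
    exact Module.Finite.of_finite⟩
  toIsTriangulatedClosed₂ := .mk' fun T hT h₁ h₃ n => by
    have h₁ : Module.Finite R ((homologyFunctor (ModuleCat.{u} R) n).obj T.obj₁) := h₁ n
    have h₃ : Module.Finite R ((homologyFunctor (ModuleCat.{u} R) n).obj T.obj₃) := h₃ n
    have h := (ShortComplex.ShortExact.moduleCat_exact_iff_function_exact _).1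
      (HomologySequence.exact₂ T hT n)
    have : IsNoetherian R ((homologyFunctor (ModuleCat.{u} R) n).obj T.obj₂) :=
      isNoetherian_of_range_eq_ker _ _ h.linearMap_ker_eq.symm
    exact (inferInstance :
      Module.Finite R ((homologyFunctor (ModuleCat.{u} R) n).obj T.obj₂))

/-! ### The sum of bands -/

namespace CochainComplex

variable {T : CochainComplex (ModuleCat.{u} R) ℤ}

/-- The direct sum of the truncations of `T` in the degrees from `-n-2` to `n`. -/
noncomputable abbrev sumBands (T : CochainComplex (ModuleCat.{u} R) ℤ) :
    CochainComplex (ModuleCat.{u} R) ℤ :=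
  T.sumCut fun n i => -(n : ℤ) - 2 ≤ i ∧ i ≤ n

lemma prop_sumBands_of_isTriangulated (hT : T.Acyclic)
    (E : ObjectProperty (DerivedCategory (ModuleCat.{u} R))) [E.IsTriangulated]
    [E.IsClosedUnderIsomorphisms]
    (hE : ∀ P : ℕ → ℤ → Prop, (∀ i, {n | P n i}.Finite) → E (Q.obj (T.sumCut P))) :
    E (Q.obj T.sumBands) := by
  -- Degrees `> n` form the subcomplex and degrees `≤ n` the quotient. The middle term is acyclic,
  -- so the quotient satisfies `E` once the subcomplex does; in degree `i` the latter involves only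
  -- `n < i`.
  have h₁ := triangleOfSES_distinguished (sumCut_shortExact (T := T)
    (P := fun n i => (n : ℤ) < i) (P' := fun _ _ => True) (P'' := fun n i => i ≤ n)
    (by intros; lia) (by intros; lia) (by intros; lia) (by intros; lia) (by intros; lia)
    (by intros; lia))
  have h₂ := triangleOfSES_distinguished (sumCut_shortExact (T := T)
    (P := fun n i => -(n : ℤ) - 2 ≤ i ∧ i ≤ n) (P' := fun n i => i ≤ n)
    (P'' := fun n i => i < -(n : ℤ) - 2)
    (by intros; lia) (by intros; lia) (by intros; lia) (by intros; lia) (by intros; lia)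
    (by intros; lia))
  -- In `h₂` the bands are the subcomplex of the part in degrees `≤ n`, and the quotient involves
  -- only `n < -i - 2` in degree `i`.
  refine E.ext_of_isTriangulatedClosed₁ _ h₂ (E.ext_of_isTriangulatedClosed₃ _ h₁ ?_ ?_) ?_
  · exact hE _ fun i => (Set.finite_lt_nat i.toNat).subset fun n (hn : (n : ℤ) < i) =>
      (by lia : n < i.toNat)
  · refine E.prop_of_isZero ?_
    exact isZero_Q_obj_of_acyclic (sumCut_acyclic hT)
  · exact hE _ fun i => (Set.finite_lt_nat (-i).toNat).subset fun n (hn : i < -(n : ℤ) - 2) =>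
      (by lia : n < (-i).toNat)

lemma isEmpty_retract_sumBands [IsNoetherianRing R] {S : ModuleCat.{u} R} [IsSimpleModule R S]
    (hS : ¬ Module.Projective R S) [∀ i, Projective (T.X i)] [∀ i, Injective (T.X i)]
    (p : T.X (-1) →ₗ[R] S) (hp : Function.Surjective p)
    (hpd : LinearMap.ker p = LinearMap.range (T.d (-2) (-1)).hom)
    (X : CochainComplex (ModuleCat.{u} R) ℤ) [Module.Finite R (X.X (-1))] :
    IsEmpty (Retract (Q.obj T.sumBands) (Q.obj X)) := by
  refine ⟨fun r => ?_⟩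
  -- `P m` selects the single band of index `m`. The bounds `-m-2` and `m` ensure that even the band
  -- `m = 0` contains the degrees `-2`, `-1`, `0` used by the obstruction.
  let P : ℕ → ℕ → ℤ → Prop := fun m n i => n = m ∧ -(n : ℤ) - 2 ≤ i ∧ i ≤ n
  have hproj (m : ℕ) : (T.sumCut (P m)).IsKProjective :=
    isKProjective_sumCut m fun n i h => by obtain ⟨rfl, h⟩ := h; exact h.2
  have hinj (m : ℕ) : (T.sumCut (P m)).IsKInjective :=
    isKInjective_sumCut (-(m : ℤ) - 2) (fun n i h => by obtain ⟨rfl, h⟩ := h; exact h.1)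
      fun i => (Set.finite_singleton m).subset fun n hn => hn.1
  let inc (m : ℕ) : T.sumCut (P m) ⟶ T.sumBands := T.sumCutMap _ _ (by intros; lia)
  let pr (m : ℕ) : T.sumBands ⟶ T.sumCut (P m) := T.sumCutMap _ _ (by intros; lia)
  have h₁ (m : ℕ) : inc m ≫ pr m = 𝟙 _ := sumCutMap_comp_of_subset _ _ fun n i h => h.2
  have h₂ (m m' : ℕ) (h : m ≠ m') : inc m ≫ pr m' = 0 :=
    sumCutMap_comp_of_disjoint _ _ fun n i hn _ hn' => h (hn.1.symm.trans hn'.1)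
  -- Nothing is known about `X` or the whole sum of bands; the lifts exist because each single band
  -- is both K-projective and K-injective.
  choose a ha using fun m => Q_map_surjective_of_isKProjective _ X (Q.map (inc m) ≫ r.i)
  choose b hb using fun m => Q_map_surjective_of_isKInjective X _ (r.r ≫ Q.map (pr m))
  have hab (m m' : ℕ) : Q.map (a m ≫ b m') = Q.map (inc m ≫ pr m') := by
    simp [ha, hb]
  refine false_of_homotopy_sumCut hS p hp hpd P (fun n => ⟨rfl, by lia⟩) (fun n => ⟨rfl, by lia⟩)
    (fun n => ⟨rfl, by lia⟩) X a b
    (fun n => nonempty_homotopy_of_Q_map_eq ((hab n n).trans (by rw [h₁])))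
    fun n m hnm => nonempty_homotopy_of_Q_map_eq ((hab n m).trans (by rw [h₂ n m hnm]))

end CochainComplex

end

end

theorem theorem3p1 (R : Type u) [Ring R] [IsQuasiFrobenius R]
    [HasDerivedCategory.{w₁} (FGModuleCat.{u} R)] [HasDerivedCategory.{w₂} (ModuleCat.{u} R)]
    (hR : globalDimension R = ⊤) :
    ¬ (derivedModInclusion R).Full ∧
      (derivedModInclusion R).essImage.retractClosure < hasFGCohomology R ∧
      ¬ (derivedModInclusionLift R).IsEquivalence := by
  obtain ⟨S, hS, hS'⟩ := exists_simple_not_projective hR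
  have : Module.Finite R S := inferInstance
  obtain ⟨T, hT, hfin, hproj, hinj, p, hp, hpd⟩ := IsQuasiFrobenius.exists_acyclic_complex S
  have hcut (P : ℕ → ℤ → Prop) (hP : ∀ i, {n | P n i}.Finite) :
      (derivedModInclusion R).essImage (DerivedCategory.Q.obj (T.sumCut P)) :=
    mem_essImage_derivedModInclusion _ fun i => CochainComplex.finite_sumCut_X i (hP i)
  have hle : (derivedModInclusion R).essImage ≤ hasFGCohomology R := by
    rintro Y ⟨X, ⟨e⟩⟩
    exact (hasFGCohomology R).prop_of_iso e (hasFGCohomology_derivedModInclusion_obj R X)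
  have hFG : hasFGCohomology R (DerivedCategory.Q.obj T.sumBands) :=
    CochainComplex.prop_sumBands_of_isTriangulated hT _ fun P hP => hle _ (hcut P hP)
  have hnot : ¬ (derivedModInclusion R).essImage.retractClosure
      (DerivedCategory.Q.obj T.sumBands) := by
    rintro ⟨Y, hY, ⟨r⟩⟩
    obtain ⟨K, hK, ⟨e⟩⟩ := (essImage_derivedModInclusion_iff Y).1 hY
    have := hK (-1)
    exact (CochainComplex.isEmpty_retract_sumBands hS' p hp hpd K).false
      (r.trans (Retract.ofIso e))
  have hnot' : ¬ (derivedModInclusion R).essImage (DerivedCategory.Q.obj T.sumBands) :=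
    fun h => hnot (ObjectProperty.le_retractClosure _ _ h)
  refine ⟨fun hfull => ?_, ?_, fun heq => ?_⟩
  -- Fullness lets the connecting morphisms of triangles lift to `D(mod R)`, which makes the
  -- essential image a triangulated subcategory.
  · have : (modInclusion R).mapDerivedCategory.Full := hfull
    exact hnot' (CochainComplex.prop_sumBands_of_isTriangulated hT
      (modInclusion R).mapDerivedCategory.essImage hcut)
  · exact lt_of_le_of_ne ((ObjectProperty.retractClosure_le_iff _ _).2 hle)
      fun h => hnot (h ▸ hFG)
  · let X := (derivedModInclusionLift R).objPreimage ⟨_, hFG⟩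
    exact hnot' ⟨X, ⟨(hasFGCohomology R).ι.mapIso
      ((derivedModInclusionLift R).objObjPreimageIso ⟨_, hFG⟩)⟩⟩
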